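/- For a finite field $F$ with $q$ elements, an integer $n\ge 2$ with $\gcd(n,q)=1$, a primitive $n$-th root of unity $\beta$ in an extension field of $F$, an integer $\delta$ with $2\le\delta\le n$ and an integer $h\ge 0$, the BCH code $\mathcal C_{(q,n,\delta,h)}$ is the cyclic code of length $n$ over $F$ generated by $$\operatorname{lcm}\bigl(M_{\beta^{h}}(x),M_{\beta^{h+1}}(x),\dots,M_{\beta^{h+\delta-2}}(x)\bigr)\in F[x],$$ where $M_{\beta^{j}}(x)$ is the minimal polynomial of $\beta^{j}$ over $F$; that is, it consists of the vectors $(c_0,\dots,c_{n-1})\in F^n$ for which the class of $c_0+c_1x+\dots+c_{n-1}x^{n-1}$ lies in the ideal of $F[x]/(x^n-1)$ generated by this polynomial. For a subfield $K$ of $F$ and a linear code $\mathcal C\subseteq F^n$, the subfield subcode is $\mathcal C|_{K}=\mathcal C\cap K^n$, a linear code over $K$. The minimum distance of a nonzero linear code is the least Hamming weight of a nonzero codeword. **Theorem.** Let $q=2^s$ with $s\ge 2$ an even integer, and let $h=q/4$. Then, for every choice of the primitive $(q+1)$-th root of unity $\beta$, the quaternary subfield subcode $\mathcal C_{(q,q+1,3,h)}|_{\mathbb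 F_4}$ has parameters $[q+1,\,q+1-2s,\,d\ge 5]$: it has length $q+1$, its dimension over $\mathbb F_4$ is $q+1-2s$ (which is positive), and its minimum distance is at least $5$. -/

import Mathlib

open Polynomial

noncomputable section

/-- The polynomial `c₀ + c₁ X + ⋯ + cₙ₋₁ X ^ (n - 1)` attached to a vector `c` of length `n`. -/
def vecPoly (F : Type*) [Field F] (n : ℕ) : (Fin n → F) →ₗ[F] F[X] :=
  ∑ i : Fin n, (Polynomial.monomial (i : ℕ)).comp (LinearMap.proj i)

/-- The cyclic code of length `n` over `F` generated by `g`: the vectors `c` whose class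
`c₀ + c₁ X + ⋯ + cₙ₋₁ X ^ (n - 1)` in `F[X] / (X ^ n - 1)` lies in the ideal generated
by the class of `g`. -/
def cyclicCode (F : Type*) [Field F] (n : ℕ) (g : F[X]) : Submodule F (Fin n → F) :=
  Submodule.comap
    ((Ideal.Quotient.mkₐ F (Ideal.span {(X ^ n - 1 : F[X])})).toLinearMap ∘ₗ vecPoly F n)
    (Submodule.restrictScalars F
      (Ideal.span {Ideal.Quotient.mk (Ideal.span {(X ^ n - 1 : F[X])}) g}))

open Classical in
/-- The monic least common multiple, in `F[X]`, of the minimal polynomials over `F` of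
`β ^ h, β ^ (h + 1), …, β ^ (h + δ - 2)`. -/
def bchGenerator (F : Type*) [Field F] {E : Type*} [Field E] [Algebra F E]
    (β : E) (δ h : ℕ) : F[X] :=
  letI : StrongNormalizedGCDMonoid F[X] :=
    UniqueFactorizationMonoid.toStrongNormalizedGCDMonoid F[X]
  (Finset.Icc h (h + δ - 2)).lcm fun j => minpoly F (β ^ j)

/-- The BCH code over `F` of length `n` and designed distance `δ` (with `2 ≤ δ ≤ n`), with
respect to a primitive `n`-th root of unity `β` in an extension field of `F` and the
exponent `h`. -/
def bchCode (F : Type*) [Field F] {E : Type*} [Field E] [Algebra F E]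
    (n : ℕ) (β : E) (δ h : ℕ) : Submodule F (Fin n → F) :=
  cyclicCode F n (bchGenerator F β δ h)

/-- The subfield subcode `C|_K = C ∩ Kⁿ`: the vectors over `K` which, read as vectors
over the larger field `F`, lie in `C`. -/
def subfieldSubcode (K : Type*) {F : Type*} [Field K] [Field F] [Algebra K F] {n : ℕ}
    (C : Submodule F (Fin n → F)) : Submodule K (Fin n → K) :=
  (C.restrictScalars K).comap ((Algebra.linearMap K F).compLeft (Fin n))

open Classical in
/-- The minimum distance: the least Hamming weight of a nonzero codeword
(and `0` for the zero code). -/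
def minDistance {K : Type*} [Field K] {n : ℕ} (C : Submodule K (Fin n → K)) : ℕ :=
  sInf {w | ∃ c ∈ C, c ≠ 0 ∧ hammingNorm c = w}

end

/-! Write `q = 4 ^ (k + 1)`, so `s = 2 * k + 2` and `h = 4 ^ k`. A word over `𝔽₄` has a polynomial
whose zero set is stable under `x ↦ x ^ 4`. Since `β ^ h` is conjugate to `β`, and `4 * (h + 1) ≡ 3`
modulo `q + 1`, the subfield subcode is the cyclic code over `𝔽₄` with zeros `β` and `β ^ 3`.

Dimension: `4` has order `s` modulo `q + 1` and `3` is not a power of `4` there, so the two minimal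
polynomials are coprime, each of degree `s`.

Distance: the `q`-power map inverts `(q + 1)`-th roots of unity, so the exponents `-3, -1, 1, 3` are
all zeros. They form a progression of step `2`, prime to the odd length, and the BCH bound gives
`5`. -/

/-! ### Cyclic and BCH codes through divisibility and zeros -/

theorem vecPoly_apply {F : Type*} [Field F] {n : ℕ} (c : Fin n → F) :
    vecPoly F n c = ∑ i : Fin n, monomial (i : ℕ) (c i) := by
  simp [vecPoly]

theorem vecPoly_coeff {F : Type*} [Field F] {n : ℕ} (c : Fin n → F) (i : Fin n) :
    (vecPoly F n c).coeff i = c i := by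
  simp [vecPoly_apply, finsetSum_coeff, coeff_monomial, Fin.val_inj]

theorem vecPoly_degree_lt {F : Type*} [Field F] {n : ℕ} (c : Fin n → F) :
    (vecPoly F n c).degree < n := by
  rw [vecPoly_apply]
  refine (degree_sum_le _ _).trans_lt ((Finset.sup_lt_iff (WithBot.bot_lt_coe n)).2 fun i _ => ?_)
  exact (degree_monomial_le _ _).trans_lt (Nat.cast_lt.2 i.2)

theorem vecPoly_coeff_of_degree_lt {F : Type*} [Field F] {n : ℕ} {p : F[X]} (hp : p.degree < n) :
    vecPoly F n (fun i => p.coeff i) = p := by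
  ext j
  by_cases hj : j < n
  · exact vecPoly_coeff (fun i : Fin n => p.coeff i) ⟨j, hj⟩
  · have hj' : (n : WithBot ℕ) ≤ j := by exact_mod_cast not_lt.1 hj
    rw [coeff_eq_zero_of_degree_lt (hp.trans_le hj'),
      coeff_eq_zero_of_degree_lt ((vecPoly_degree_lt _).trans_le hj')]

theorem aeval_vecPoly {F E : Type*} [Field F] [Field E] [Algebra F E] {n : ℕ} (c : Fin n → F)
    (x : E) : aeval x (vecPoly F n c) = ∑ i : Fin n, algebraMap F E (c i) * x ^ (i : ℕ) := by
  simp [vecPoly_apply, aeval_monomial]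

/-- Membership in a cyclic code is divisibility by the generator. -/
theorem mem_cyclicCode_iff {F : Type*} [Field F] {n : ℕ} {g : F[X]} (hg : g ∣ X ^ n - 1)
    (c : Fin n → F) : c ∈ cyclicCode F n g ↔ g ∣ vecPoly F n c := by
  have h : c ∈ cyclicCode F n g ↔ Ideal.Quotient.mk (Ideal.span {(X ^ n - 1 : F[X])})
      (vecPoly F n c) ∈ (Ideal.span {g}).map
        (Ideal.Quotient.mk (Ideal.span {(X ^ n - 1 : F[X])})) := by
    rw [Ideal.map_span, Set.image_singleton]
    rfl
  rw [h, Ideal.mem_quotient_iff_mem, Ideal.mem_span_singleton]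
  rwa [Ideal.span_singleton_le_span_singleton]

theorem bchGenerator_dvd_iff {F E : Type*} [Field F] [Field E] [Algebra F E]
    (β : E) (δ h : ℕ) (p : F[X]) :
    bchGenerator F β δ h ∣ p ↔ ∀ j ∈ Finset.Icc h (h + δ - 2), aeval (β ^ j) p = 0 := by
  classical
  unfold bchGenerator
  rw [Finset.lcm_dvd_iff]
  simp only [minpoly.dvd_iff]

/-- A vector lies in a BCH code iff its polynomial vanishes at the prescribed powers of `β`. -/
theorem mem_bchCode_iff {F E : Type*} [Field F] [Field E] [Algebra F E] {n : ℕ} {β : E}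
    (hβ : β ^ n = 1) (δ h : ℕ) (c : Fin n → F) :
    c ∈ bchCode F n β δ h ↔
      ∀ j ∈ Finset.Icc h (h + δ - 2), aeval (β ^ j) (vecPoly F n c) = 0 := by
  rw [bchCode, mem_cyclicCode_iff, bchGenerator_dvd_iff]
  rw [bchGenerator_dvd_iff]
  intro j _
  simp [← pow_mul, mul_comm j n, pow_mul β n, hβ]

theorem mem_subfieldSubcode_bchCode_iff {K F E : Type*} [Field K] [Field F] [Field E]
    [Algebra K F] [Algebra F E] [Algebra K E] [IsScalarTower K F E] {n : ℕ} {β : E}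
    (hβ : β ^ n = 1) (δ h : ℕ) (c : Fin n → K) :
    c ∈ subfieldSubcode K (bchCode F n β δ h) ↔
      ∀ j ∈ Finset.Icc h (h + δ - 2), aeval (β ^ j) (vecPoly K n c) = 0 := by
  have h1 : c ∈ subfieldSubcode K (bchCode F n β δ h) ↔
      (fun i => algebraMap K F (c i)) ∈ bchCode F n β δ h := Iff.rfl
  rw [h1, mem_bchCode_iff hβ]
  simp only [aeval_vecPoly, ← IsScalarTower.algebraMap_apply K F E]

/-- The space of vectors whose polynomial is divisible by `g` has codimension `deg g`. -/
theorem finrank_eq_of_mem_iff_dvd {K : Type*} [Field K] {n : ℕ} {g : K[X]} (hg0 : g ≠ 0)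
    (hg : g.natDegree ≤ n) (C : Submodule K (Fin n → K))
    (hC : ∀ c, c ∈ C ↔ g ∣ vecPoly K n c) :
    Module.finrank K C = n - g.natDegree := by
  -- Reduction modulo `g` has kernel `C`; it is onto because every remainder has degree below `deg g
  -- ≤ n`.
  let f : (Fin n → K) →ₗ[K] K[X] ⧸ Ideal.span {g} :=
    (Ideal.Quotient.mkₐ K (Ideal.span {g})).toLinearMap ∘ₗ vecPoly K n
  have hker : LinearMap.ker f = C := by
    ext c
    rw [hC, LinearMap.mem_ker, ← Ideal.mem_span_singleton]
    exact Ideal.Quotient.eq_zero_iff_mem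
  have hf : LinearMap.range f = ⊤ := by
    refine LinearMap.range_eq_top.2 fun y => ?_
    obtain ⟨p, rfl⟩ := Ideal.Quotient.mk_surjective y
    have hd : (p % g).degree < n := (degree_mod_lt p hg0).trans_le
      ((degree_eq_natDegree hg0).trans_le (by exact_mod_cast hg))
    refine ⟨fun i => (p % g).coeff i, ?_⟩
    change Ideal.Quotient.mk _ (vecPoly K n _) = _
    rw [vecPoly_coeff_of_degree_lt hd, Ideal.Quotient.eq, Ideal.mem_span_singleton]
    exact ⟨-(p / g), by linear_combination EuclideanDomain.mod_add_div p g⟩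
  have h := LinearMap.finrank_range_add_finrank_ker f
  rw [hker, hf, finrank_top, finrank_quotient_span_eq_natDegree, Module.finrank_fin_fun] at h
  omega

/-! ### The BCH bound -/

/-- Vandermonde: a nonzero sequence whose first power sums vanish has large support. -/
theorem eq_zero_of_sum_mul_pow_eq_zero {E ι : Type*} [Field E] [DecidableEq ι] (S : Finset ι)
    {a y : ι → E} (hy : Set.InjOn y S)
    (h : ∀ j < S.card, ∑ i ∈ S, a i * y i ^ j = 0) : ∀ i ∈ S, a i = 0 := by
  have hp : ∀ p : E[X], p.natDegree < S.card → ∑ i ∈ S, a i * p.eval (y i) = 0 := by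
    intro p hp
    simp only [eval_eq_sum_range, Finset.mul_sum]
    rw [Finset.sum_comm]
    refine Finset.sum_eq_zero fun j hj => ?_
    rw [Finset.mem_range] at hj
    simp only [mul_left_comm (a _), ← Finset.mul_sum]
    rw [h j (by omega), mul_zero]
  intro i hi
  -- The Lagrange product, of degree `S.card - 1`, vanishes at every node except `y i`.
  have h0 := hp (∏ k ∈ S.erase i, (X - C (y k))) (by
    rw [natDegree_finsetProd_X_sub_C_eq_card, Finset.card_erase_of_mem hi]
    exact Nat.sub_lt (Finset.card_pos.2 ⟨i, hi⟩) one_pos)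
  rw [Finset.sum_eq_single_of_mem i hi] at h0
  · refine (mul_eq_zero.1 h0).resolve_right ?_
    rw [eval_prod]
    refine Finset.prod_ne_zero_iff.2 fun k hk => ?_
    rw [Finset.mem_erase] at hk
    simpa [sub_eq_zero] using fun e => hk.1 (hy hk.2 hi e.symm)
  · intro k hk hki
    rw [eval_prod, Finset.prod_eq_zero (Finset.mem_erase.2 ⟨hki, hk⟩) (by simp), mul_zero]

open Classical in
/-- The BCH bound for zeros `β ^ (b + a j)` in arithmetic progression of step `a` prime to `n`. -/
theorem lt_hammingNorm_of_aeval_eq_zero {K E : Type*} [Field K] [Field E] [Algebra K E] {n : ℕ}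
    {β : E} (hβ : IsPrimitiveRoot β n) {a : ℕ} (ha : a.Coprime n) (b t : ℕ) {c : Fin n → K}
    (hc : c ≠ 0) (h : ∀ j < t, aeval (β ^ (b + a * j)) (vecPoly K n c) = 0) :
    t < hammingNorm c := by
  by_contra! hlt
  obtain ⟨i, hi⟩ := Function.ne_iff.1 hc
  have hβ0 : β ≠ 0 := hβ.ne_zero i.pos.ne'
  -- The offset `b` is absorbed into the coefficients; the nodes `β ^ (a i)` are distinct because
  -- `a` is prime to `n`.
  have key := eq_zero_of_sum_mul_pow_eq_zero (Finset.univ.filter fun i => c i ≠ 0)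
    (a := fun i : Fin n => algebraMap K E (c i) * β ^ (b * i))
    (y := fun i : Fin n => (β ^ a) ^ (i : ℕ))
    (fun i _ j _ hij => Fin.ext ((hβ.pow_of_coprime a ha).pow_inj i.2 j.2 hij)) (fun j hj => by
      rw [Finset.sum_filter_of_ne (p := fun i => c i ≠ 0) (fun i _ hi hci => hi (by simp [hci])),
        ← h j (hj.trans_le hlt), aeval_vecPoly]
      refine Finset.sum_congr rfl fun i _ => ?_
      ring) i (by simpa using hi)
  simp only [mul_eq_zero, map_eq_zero, pow_eq_zero_iff', hβ0, false_and, or_false] at key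
  exact hi key

/-! ### Conjugates over `𝔽₄` and powers of `4` modulo `4 ^ (k + 1) + 1` -/

theorem aeval_pow_card_pow_eq_zero {K E : Type*} [Field K] [Finite K] [Field E] [Algebra K E]
    {p : K[X]} {x : E} (hx : aeval x p = 0) (k : ℕ) : aeval (x ^ Nat.card K ^ k) p = 0 := by
  have := Fintype.ofFinite K
  induction k with
  | zero => simpa using hx
  | succ k ih =>
    rw [pow_succ, pow_mul, ← expand_aeval, Nat.card_eq_fintype_card, FiniteField.expand_card,
      map_pow, ← Nat.card_eq_fintype_card, ih, zero_pow Nat.card_pos.ne']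

/-- As `4 ^ (k + 1) = -1`, the order divides `2 * k + 2`. A proper divisor `d` is at most `k + 1`,
so `4 ^ d` is below the modulus and could be congruent to `1` only by equalling it. -/
theorem orderOf_four (k : ℕ) : orderOf ((4 : ℕ) : ZMod (4 ^ (k + 1) + 1)) = 2 * k + 2 := by
  have hm : ((4 : ℕ) : ZMod (4 ^ (k + 1) + 1)) ^ (k + 1) = -1 := by
    rw [eq_neg_iff_add_eq_zero]
    exact_mod_cast ZMod.natCast_self (4 ^ (k + 1) + 1)
  have hd : orderOf ((4 : ℕ) : ZMod (4 ^ (k + 1) + 1)) ∣ 2 * k + 2 := by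
    rw [orderOf_dvd_iff_pow_eq_one, show 2 * k + 2 = (k + 1) * 2 by ring, pow_mul, hm]
    ring
  obtain ⟨e, he⟩ := hd
  set d := orderOf ((4 : ℕ) : ZMod (4 ^ (k + 1) + 1)) with hdef
  have hd0 : d ≠ 0 := by rintro h; rw [h] at he; omega
  rcases Nat.lt_or_ge e 2 with h2 | h2
  · interval_cases e <;> omega
  · exfalso
    have hle : d ≤ k + 1 := by nlinarith
    have h1 : ((4 : ℕ) : ZMod (4 ^ (k + 1) + 1)) ^ d = 1 := pow_orderOf_eq_one _
    have h3 : 4 ^ d ≡ 1 [MOD 4 ^ (k + 1) + 1] := by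
      rw [← ZMod.natCast_eq_natCast_iff]
      exact_mod_cast h1
    have h4 := h3.eq_of_lt_of_lt (Nat.lt_succ_of_le (Nat.pow_le_pow_right (by norm_num) hle))
      (Nat.succ_lt_succ (by positivity))
    exact hd0 ((Nat.pow_eq_one.1 h4).resolve_left (by norm_num))

/-- For `i ≤ k + 1` both sides are below the modulus. Beyond that, `4 ^ (k + 1 + j) ≡ -4 ^ j`, and
`4 ^ j + 3` is positive but too small to be a multiple of the modulus. -/
theorem four_pow_not_modEq_three (k i : ℕ) (hi : i < 2 * k + 2) :
    ¬ 4 ^ i ≡ 3 [MOD 4 ^ (k + 1) + 1] := by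
  have h4 : 4 ≤ 4 ^ (k + 1) := by rw [pow_succ]; have := Nat.one_le_pow k 4 (by norm_num); omega
  intro h
  rcases Nat.lt_or_ge i (k + 1) with hlt | hge
  · have h1 := h.eq_of_lt_of_lt
      (Nat.lt_succ_of_le (Nat.pow_le_pow_right (by norm_num) hlt.le)) (by omega)
    cases i with
    | zero => simp at h1
    | succ i => rw [pow_succ] at h1; omega
  · obtain ⟨j, rfl⟩ := Nat.exists_eq_add_of_le hge
    have hj : 4 ^ j ≤ 4 ^ k := Nat.pow_le_pow_right (by norm_num) (by omega)
    have h1 : 4 ^ j + 3 ≡ 4 ^ j + 4 ^ (k + 1 + j) [MOD 4 ^ (k + 1) + 1] := h.symm.add_left _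
    have h2 : 4 ^ (k + 1) + 1 ∣ 4 ^ j + 3 := by
      rw [← Nat.modEq_zero_iff_dvd]
      exact h1.trans ((Nat.modEq_zero_iff_dvd).2 ⟨4 ^ j, by ring⟩)
    have h3 := Nat.le_of_dvd (Nat.succ_pos _) h2
    have h5 := Nat.one_le_pow k 4 (by norm_num)
    rw [pow_succ] at h3
    omega

/-- Every irreducible factor over `𝔽₄` of the cyclotomic polynomial has degree the order of `4`
modulo the index. -/
theorem natDegree_minpoly_of_card_eq_four {K E : Type*} [Field K] [Field E] [Algebra K E]
    (hK : Nat.card K = 4) {k : ℕ} {β : E} (hβ : IsPrimitiveRoot β (4 ^ (k + 1) + 1)) :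
    (minpoly K β).natDegree = 2 * k + 2 := by
  have : Finite K := Nat.finite_of_card_ne_zero (by omega)
  have := Fintype.ofFinite K
  have hn : Nat.Coprime 2 (4 ^ (k + 1) + 1) := by
    rw [Nat.coprime_two_left, pow_succ]
    exact ⟨4 ^ k * 2, by ring⟩
  have hint : IsIntegral K β := IsIntegral.of_pow (Nat.succ_pos _) (hβ.pow_eq_one ▸ isIntegral_one)
  have : Fact (Nat.Prime 2) := ⟨Nat.prime_two⟩
  rw [natDegree_of_dvd_cyclotomic_of_irreducible (f := 2) (p := 2) (n := 4 ^ (k + 1) + 1)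
    (by rw [← Nat.card_eq_fintype_card, hK]; norm_num) hn ?_ (minpoly.irreducible hint),
    ← orderOf_units, ZMod.coe_unitOfCoprime]
  · exact orderOf_four k
  · have hr := hβ.isRoot_cyclotomic (Nat.succ_pos _)
    rw [minpoly.dvd_iff, ← eval_map_algebraMap, map_cyclotomic]
    exact hr

theorem IsPrimitiveRoot.pow_eq_pow_iff {E : Type*} [Field E] {n : ℕ} {β : E}
    (hβ : IsPrimitiveRoot β n) (hn : n ≠ 0) (i j : ℕ) : β ^ i = β ^ j ↔ i ≡ j [MOD n] := by
  rw [← pow_mod_orderOf, ← pow_mod_orderOf β j, ← hβ.eq_orderOf]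
  exact ⟨hβ.pow_inj (Nat.mod_lt _ (Nat.pos_of_ne_zero hn)) (Nat.mod_lt _ (Nat.pos_of_ne_zero hn)),
    fun h => congrArg _ h⟩

/-- Otherwise `β ^ 3` would be a root besides the `2 * k + 2` distinct conjugates `β ^ 4 ^ i`, one
more than the degree allows. -/
theorem minpoly_ne_minpoly_pow_three {K E : Type*} [Field K] [Field E] [Algebra K E]
    (hK : Nat.card K = 4) {k : ℕ} {β : E} (hβ : IsPrimitiveRoot β (4 ^ (k + 1) + 1)) :
    minpoly K β ≠ minpoly K (β ^ 3) := by
  classical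
  intro heq
  have : Finite K := Nat.finite_of_card_ne_zero (by omega)
  have hint : IsIntegral K β := IsIntegral.of_pow (Nat.succ_pos _) (hβ.pow_eq_one ▸ isIntegral_one)
  have hmod := hβ.pow_eq_pow_iff (Nat.succ_ne_zero _)
  have hmem : ∀ x : E, aeval x (minpoly K β) = 0 → x ∈ ((minpoly K β).aroots E).toFinset :=
    fun x hx => by
      rw [Multiset.mem_toFinset, mem_aroots]
      exact ⟨minpoly.ne_zero hint, hx⟩
  have hsub : insert (β ^ 3) ((Finset.range (2 * k + 2)).image fun i => β ^ 4 ^ i) ⊆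
      ((minpoly K β).aroots E).toFinset := by
    intro x hx
    rw [Finset.mem_insert, Finset.mem_image] at hx
    obtain rfl | ⟨i, -, rfl⟩ := hx
    · exact hmem _ (heq ▸ minpoly.aeval K (β ^ 3))
    · refine hmem _ ?_
      rw [← hK]
      exact aeval_pow_card_pow_eq_zero (minpoly.aeval K β) i
  have hcard := (Finset.card_le_card hsub).trans
    ((Multiset.toFinset_card_le _).trans ((card_roots' _).trans natDegree_map_le))
  rw [natDegree_minpoly_of_card_eq_four hK hβ, Finset.card_insert_of_notMem,
    Finset.card_image_of_injOn, Finset.card_range] at hcard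
  · omega
  · intro i hi j hj hij
    rw [Finset.coe_range, Set.mem_Iio, ← orderOf_four k] at hi hj
    refine pow_injOn_Iio_orderOf hi hj ?_
    have h1 := (ZMod.natCast_eq_natCast_iff _ _ _).2 ((hmod _ _).1 hij)
    rwa [Nat.cast_pow, Nat.cast_pow] at h1
  · rw [Finset.mem_image]
    rintro ⟨i, hi, h⟩
    exact four_pow_not_modEq_three k i (Finset.mem_range.1 hi) ((hmod _ _).1 h)

/-! ### The quaternary code with zeros `β` and `β ^ 3` -/

theorem pow_four_pow_eq_self {E : Type*} [Field E] {k : ℕ} {x : E}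
    (hx : x ^ (4 ^ (k + 1) + 1) = 1) : x ^ 4 ^ (2 * k + 2) = x := by
  have h : x ^ 4 ^ (k + 1) = x⁻¹ := eq_inv_of_mul_eq_one_left (by rwa [← pow_succ])
  rw [show 2 * k + 2 = (k + 1) + (k + 1) by ring, pow_add 4, pow_mul, h, inv_pow, h, inv_inv]

/-- For polynomials over `𝔽₄`, vanishing at `β ^ h` and `β ^ (h + 1)` with `h = 4 ^ k` and
`β ^ (4 h + 1) = 1` amounts to vanishing at `β` and `β ^ 3`. -/
theorem aeval_eq_zero_iff_of_card_eq_four {K E : Type*} [Field K] [Field E] [Algebra K E]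
    (hK : Nat.card K = 4) {k : ℕ} {β : E} (hβ : β ^ (4 ^ (k + 1) + 1) = 1) (p : K[X]) :
    (aeval (β ^ 4 ^ k) p = 0 ∧ aeval (β ^ (4 ^ k + 1)) p = 0) ↔
      aeval β p = 0 ∧ aeval (β ^ 3) p = 0 := by
  have : Finite K := Nat.finite_of_card_ne_zero (by omega)
  have hpow : ∀ {x : E}, aeval x p = 0 → ∀ i, aeval (x ^ 4 ^ i) p = 0 := fun hx i => by
    rw [← hK]
    exact aeval_pow_card_pow_eq_zero hx i
  have h3 : (β ^ (4 ^ k + 1)) ^ 4 ^ 1 = β ^ 3 := by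
    rw [← pow_mul, show (4 ^ k + 1) * 4 ^ 1 = 4 ^ (k + 1) + 1 + 3 by ring, pow_add, hβ, one_mul]
  constructor
  · rintro ⟨h1, h2⟩
    refine ⟨?_, h3 ▸ hpow h2 1⟩
    have h := hpow h1 (k + 2)
    rwa [← pow_mul, ← pow_add, show k + (k + 2) = 2 * k + 2 by ring, pow_four_pow_eq_self hβ] at h
  · rintro ⟨h1, h2⟩
    refine ⟨hpow h1 k, ?_⟩
    -- One Frobenius step takes `β ^ (4 ^ k + 1)` to `β ^ 3`; the remaining `2 * k + 1` steps close
    -- the cycle.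
    have h := hpow h2 (2 * k + 1)
    rwa [← h3, ← pow_mul, ← pow_add, show 1 + (2 * k + 1) = 2 * k + 2 by ring,
      pow_four_pow_eq_self] at h
    rw [← pow_mul, mul_comm, pow_mul, hβ, one_pow]

open Classical in
theorem five_le_hammingNorm_of_card_eq_four {K E : Type*} [Field K] [Field E] [Algebra K E]
    (hK : Nat.card K = 4) {k : ℕ} {β : E} (hβ : IsPrimitiveRoot β (4 ^ (k + 1) + 1))
    {c : Fin (4 ^ (k + 1) + 1) → K} (hc : c ≠ 0) (h1 : aeval β (vecPoly K _ c) = 0)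
    (h3 : aeval (β ^ 3) (vecPoly K _ c) = 0) : 5 ≤ hammingNorm c := by
  have : Finite K := Nat.finite_of_card_ne_zero (by omega)
  have hodd : Nat.Coprime 2 (4 ^ (k + 1) + 1) := by
    rw [Nat.coprime_two_left, pow_succ]
    exact ⟨4 ^ k * 2, by ring⟩
  -- The offset `3 * 4 ^ (k + 1)` represents `-3` modulo the length, so the four exponents are `-3,
  -- -1, 1, 3`.
  refine lt_hammingNorm_of_aeval_eq_zero hβ hodd (3 * 4 ^ (k + 1)) 4 hc fun j hj => ?_
  have hpow : ∀ {x : E}, aeval x (vecPoly K _ c) = 0 →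
      aeval (x ^ 4 ^ (k + 1)) (vecPoly K _ c) = 0 := fun hx => by
    have h := aeval_pow_card_pow_eq_zero hx (k + 1)
    rwa [hK] at h
  have hred : ∀ e i : ℕ, β ^ ((4 ^ (k + 1) + 1) * e + i) = β ^ i := fun e i => by
    rw [pow_add, pow_mul, hβ.pow_eq_one, one_pow, one_mul]
  interval_cases j
  · rw [mul_zero, add_zero, pow_mul]
    exact hpow h3
  · rw [show 3 * 4 ^ (k + 1) + 2 * 1 = (4 ^ (k + 1) + 1) * 2 + 4 ^ (k + 1) by ring, hred]
    exact hpow h1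
  · rw [show 3 * 4 ^ (k + 1) + 2 * 2 = (4 ^ (k + 1) + 1) * 3 + 1 by ring, hred, pow_one]
    exact h1
  · rw [show 3 * 4 ^ (k + 1) + 2 * 3 = (4 ^ (k + 1) + 1) * 3 + 3 by ring, hred]
    exact h3

/-- The length is `2` modulo `3`, so `β ^ 3` is again a primitive root and its minimal polynomial
has the same degree as that of `β`. -/
theorem finrank_of_mem_iff_aeval_eq_zero {K E : Type*} [Field K] [Field E] [Algebra K E]
    (hK : Nat.card K = 4) {k : ℕ} {β : E} (hβ : IsPrimitiveRoot β (4 ^ (k + 1) + 1))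
    (hk : 4 * k + 4 ≤ 4 ^ (k + 1) + 1) (C : Submodule K (Fin (4 ^ (k + 1) + 1) → K))
    (hC : ∀ c, c ∈ C ↔ aeval β (vecPoly K _ c) = 0 ∧ aeval (β ^ 3) (vecPoly K _ c) = 0) :
    Module.finrank K C = 4 ^ (k + 1) + 1 - (4 * k + 4) := by
  have hint : IsIntegral K β := IsIntegral.of_pow (Nat.succ_pos _) (hβ.pow_eq_one ▸ isIntegral_one)
  have hthree : Nat.Coprime 3 (4 ^ (k + 1) + 1) := by
    rw [Nat.Prime.coprime_iff_not_dvd Nat.prime_three, Nat.dvd_iff_mod_eq_zero, Nat.add_mod,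
      Nat.pow_mod]
    simp
  have hβ3 := hβ.pow_of_coprime 3 hthree
  have hirr := minpoly.irreducible hint
  have hirr3 := minpoly.irreducible (hint.pow 3)
  have hcop : IsCoprime (minpoly K β) (minpoly K (β ^ 3)) :=
    (hirr.coprime_iff_not_dvd).2 fun h => minpoly_ne_minpoly_pow_three hK hβ <|
      eq_of_monic_of_associated (minpoly.monic hint) (minpoly.monic (hint.pow 3))
        (hirr.associated_of_dvd hirr3 h)
  have hdeg : (minpoly K β * minpoly K (β ^ 3)).natDegree = 4 * k + 4 := by
    rw [natDegree_mul hirr.ne_zero hirr3.ne_zero, natDegree_minpoly_of_card_eq_four hK hβ,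
      natDegree_minpoly_of_card_eq_four hK hβ3]
    ring
  rw [← hdeg]
  refine finrank_eq_of_mem_iff_dvd (mul_ne_zero hirr.ne_zero hirr3.ne_zero) (hdeg.trans_le hk) C
    fun c => ?_
  rw [hC, ← minpoly.dvd_iff, ← minpoly.dvd_iff]
  exact ⟨fun h => hcop.mul_dvd h.1 h.2,
    fun h => ⟨(dvd_mul_right _ _).trans h, (dvd_mul_left _ _).trans h⟩⟩

theorem mainTheorem11
    (s q h : ℕ) (hs : 2 ≤ s) (hs_even : Even s) (hq : q = 2 ^ s) (hh : h = q / 4)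
    {K F E : Type*} [Field K] [Field F] [Field E] [Algebra K F] [Algebra F E]
    (hK : Nat.card K = 4) (hF : Nat.card F = q)
    (β : E) (hβ : IsPrimitiveRoot β (q + 1)) :
    2 * s ≤ q + 1 ∧
    Module.finrank K (subfieldSubcode K (bchCode F (q + 1) β 3 h)) = q + 1 - 2 * s ∧
    5 ≤ minDistance (subfieldSubcode K (bchCode F (q + 1) β 3 h)) := by
  let _ : Algebra K E := ((algebraMap F E).comp (algebraMap K F)).toAlgebra
  have : IsScalarTower K F E := IsScalarTower.of_algebraMap_eq fun _ => rfl
  obtain ⟨k, rfl⟩ : ∃ k, s = 2 * k + 2 := by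
    obtain ⟨m, rfl⟩ := hs_even
    exact ⟨m - 1, by omega⟩
  have hq4 : q = 4 ^ (k + 1) := by
    rw [hq, show 2 * k + 2 = 2 * (k + 1) by ring, pow_mul]
    norm_num
  clear hq
  subst hq4
  have hh4 : h = 4 ^ k := by
    rw [hh, pow_succ, Nat.mul_div_cancel _ (by norm_num)]
  clear hh
  subst hh4
  have hk : 4 * k + 4 < 4 ^ (k + 1) + 1 := by
    have h1 : k < 4 ^ k := Nat.lt_pow_self (by norm_num)
    rw [pow_succ]
    omega
  set C := subfieldSubcode K (bchCode F (4 ^ (k + 1) + 1) β 3 (4 ^ k)) with hCdef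
  have hC : ∀ c, c ∈ C ↔ aeval β (vecPoly K _ c) = 0 ∧ aeval (β ^ 3) (vecPoly K _ c) = 0 := by
    intro c
    rw [← aeval_eq_zero_iff_of_card_eq_four hK hβ.pow_eq_one, hCdef,
      mem_subfieldSubcode_bchCode_iff hβ.pow_eq_one]
    refine ⟨fun h => ⟨h _ (by simp), h _ (by simp)⟩, fun h j hj => ?_⟩
    rw [Finset.mem_Icc] at hj
    obtain rfl | rfl : j = 4 ^ k ∨ j = 4 ^ k + 1 := by omega
    · exact h.1
    · exact h.2
  have hrank := finrank_of_mem_iff_aeval_eq_zero hK hβ hk.le C hC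
  refine ⟨by omega, by rw [hrank]; congr 1; ring, ?_⟩
  -- The infimum of the empty set is `0`, so a nonzero codeword is needed; the strict inequality
  -- `hk` makes the dimension positive.
  obtain ⟨c, hcC, hc0⟩ := C.exists_mem_ne_zero_of_ne_bot (by
    rintro hbot
    rw [hbot, finrank_bot] at hrank
    omega)
  refine le_csInf ⟨_, c, hcC, hc0, rfl⟩ ?_
  rintro w ⟨d, hd, hd0, rfl⟩
  exact five_le_hammingNorm_of_card_eq_four hK hβ hd0 ((hC d).1 hd).1 ((hC d).1 hd).2
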